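/- Let $\mathcal M$ be a finite-dimensional smooth Riemannian manifold which is complete, i.e. for every $p\in\mathcal M$ the exponential map $\exp_p$ is defined on all of $T_p\mathcal M$. Let $F=(f_1,\dots,f_m):\mathcal M\to\mathbb R^m$ be continuously differentiable, and let $\nabla F$ be componentwise Lipschitz continuous with constant $L>0$: for all $i$ and every geodesic segment $\gamma:[0,1]\to\mathcal M$ from $p$ to $q$, $\|P_{\gamma,p,q}\,\mathrm{grad} f_i(p)-\mathrm{grad} f_i(q)\|\le L\,\ell(\gamma)$, where $P_{\gamma,p,q}$ is the parallel transport along $\gamma$ and $\ell(\gamma)$ is the length of $\gamma$. Let $\{p_k\}_{k\ge 0}$ be an infinite sequence generated by the steepest descent method: $p_{k+1}=\exp_{p_k}(t_kv_k)$ with $t_k>0$, where $$v_k=\operatorname*{argmin}_{v\in T_{p_k}\mathcal M}\Big\{\max_{1\le i\le m}\langle \mathrm{grad} f_i(p_k),v\rangle+\tfrac12\|v\|^2\Big\}$$ and $v_k\neq0$ for all $k$. For $c>0$ say that $s$ passes the $c$-test at step $k$ if $f_i(\exp_{p_k}(s v_k))\le f_i(p_k)-c\,s\,\|v_k\|^2$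 for all $i$. Let the stepsizes $t_k$ be chosen for all $k\ge0$ by one of the following three strategies, and define $\nu$ and $\xi$ accordingly. 1. (Lipschitz stepsize) $\varepsilon>0$ and $\varepsilon<t_k\le 1/L$ for all $k$. Set $\nu=1/2$, $\xi=\varepsilon$. 2. (Adaptive stepsize) $\zeta\in(0,1/2]$, $L_0>0$, $\eta\in(0,1)$, $t_{-1}:=1/L_0$, and $t_k=\eta^{i_k}t_{k-1}$, where $i_k$ is the least integer $i\ge0$ such that $\eta^i t_{k-1}$ passes the $\zeta$-test at step $k$. Assume moreover $\eta L_0\le L$ (for instance $L_0\le L$). Set $\nu=\zeta$, $\xi=\eta/L$. 3. (Armijo-type stepsize) $0<t_{\min}<t_{\max}$, $0<\omega_1<\omega_2<1$, $\delta\in(0,1)$, and $t_k$ is the first of the trial stepsizes $\hat t_0,\hat t_1,\dots$ that passes the $\delta$-test at step $k$, where $\hat t_0\in[t_{\min},t_{\max}]$ and $\hat t_{\ell+1}\in[\omega_1\hat t_\ell,\omega_2\hat t_\ell]$ are arbitrary. Assume moreover $t_{\min}<2\omega_1(1-\delta)/L$. Set $\nu=\delta$, $\xi=t_{\min}$. Put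 $f_i^*:=\inf_{q\in\mathcal M}f_i(q)\in[-\infty,\infty)$, suppose that $f_i^*>-\infty$ for some $i$, and let $i_*$ be an index such that $f_{i_*}(p_0)-f_{i_*}^*=\min_{1\le i\le m}\{f_i(p_0)-f_i^*\}$. Then, for every integer $N\ge1$, $$\min\{\|v_k\|: k=0,1,\dots,N-1\}\le\left[\frac{f_{i_*}(p_0)-f_{i_*}^*}{\nu\,\xi}\right]^{1/2}\frac1{\sqrt N}.$$ No convexity of $F$ and no curvature bound on $\mathcal M$ is assumed. -/

import Mathlib

open Set Bundle Manifold
open scoped ContDiff Topology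

noncomputable section

namespace RiemannianDescent

variable {E : Type*} [NormedAddCommGroup E] [NormedSpace ℝ E]
  {M : Type*} [TopologicalSpace M] [ChartedSpace E M] [IsManifold 𝓘(ℝ, E) ∞ M]
  [RiemannianBundle (fun x : M => TangentSpace 𝓘(ℝ, E) x)]

/-! ### Levi-Civita covariant derivative along curves, geodesics, exponential map -/

/-- The coefficients `g_y(a, b)` of the Riemannian metric in the preferred chart at `x₀`: `y : E`
is the coordinate of the base point, `a` and `b` are the coordinates of two tangent vectors. -/
def chartMetric (x₀ : M) (y a b : E) : ℝ :=
  let x : M := (extChartAt 𝓘(ℝ, E) x₀).symm y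
  let e := trivializationAt E (fun x : M => TangentSpace 𝓘(ℝ, E) x) x₀
  inner ℝ (e.symm x a) (e.symm x b)

/-- Christoffel symbols of the first kind of the Levi-Civita connection in the chart at `x₀`:
`g(Γ(a, b), w) = (∂_a g(b, w) + ∂_b g(a, w) - ∂_w g(a, b)) / 2`. -/
def christoffelFirst (x₀ : M) (y a b w : E) : ℝ :=
  (fderiv ℝ (fun z => chartMetric x₀ z b w) y a
    + fderiv ℝ (fun z => chartMetric x₀ z a w) y b
    - fderiv ℝ (fun z => chartMetric x₀ z a b) y w) / 2

/-- The number `⟨(D V/dt)(t), w⟩`, where `D V/dt` is the Levi-Civita covariant derivative of the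
vector field `V` along the curve `γ`. It is computed in the chart at `γ t`, where
`D V/dt = V' + Γ(γ', V)`, and `w` is given by its coordinates in that chart. -/
def innerCovDerivAlong (γ : ℝ → M) (V : ∀ t, TangentSpace 𝓘(ℝ, E) (γ t)) (t : ℝ) (w : E) : ℝ :=
  let c : ℝ → E := fun s => extChartAt 𝓘(ℝ, E) (γ t) (γ s)
  let a : ℝ → E := fun s =>
    (trivializationAt E (fun x : M => TangentSpace 𝓘(ℝ, E) x) (γ t) ⟨γ s, V s⟩).2
  chartMetric (γ t) (c t) (deriv a t) w + christoffelFirst (γ t) (c t) (deriv c t) (a t) w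

/-- `V` is a parallel vector field along `γ`: it is differentiable and `D V/dt = 0`. -/
def IsParallelAlong (γ : ℝ → M) (V : ∀ t, TangentSpace 𝓘(ℝ, E) (γ t)) : Prop :=
  ∀ t : ℝ,
    MDifferentiableAt 𝓘(ℝ, ℝ) 𝓘(ℝ, E).tangent
      (fun s => (⟨γ s, V s⟩ : TangentBundle 𝓘(ℝ, E) M)) t ∧
    ∀ w : E, innerCovDerivAlong γ V t w = 0

variable (E) in
/-- The velocity `γ'(t)`. -/
def velocity (γ : ℝ → M) (t : ℝ) : TangentSpace 𝓘(ℝ, E) (γ t) :=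
  mfderiv 𝓘(ℝ, ℝ) 𝓘(ℝ, E) γ t (1 : ℝ)

variable (E) in
/-- `γ : ℝ → M` is a geodesic: `D γ'/dt = 0`. -/
def IsGeodesic (γ : ℝ → M) : Prop := IsParallelAlong γ (velocity E γ)

/-- `γ` is a geodesic with `γ(0) = p` and `γ'(0) = v`. -/
def IsGeodesicFrom (p : M) (v : TangentSpace 𝓘(ℝ, E) p) (γ : ℝ → M) : Prop :=
  IsGeodesic E γ ∧
    (⟨γ 0, velocity E γ 0⟩ : TangentBundle 𝓘(ℝ, E) M) = ⟨p, v⟩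

variable (E M) in
/-- Completeness of the Riemannian manifold: for all `p` and `v ∈ T_p M`, the geodesic starting at
`p` with velocity `v` is defined for all times, so that `exp_p` is defined on all of `T_p M`. -/
def IsCompleteRiemannian : Prop :=
  ∀ (p : M) (v : TangentSpace 𝓘(ℝ, E) p), ∃ γ : ℝ → M, IsGeodesicFrom p v γ

open Classical in
/-- The exponential map `exp_p v = γ(1)`, with `γ` the geodesic with `γ(0) = p`, `γ'(0) = v`. The
default value `p` is not used on a complete manifold. -/
def expMap (p : M) (v : TangentSpace 𝓘(ℝ, E) p) : M :=
  if h : ∃ γ : ℝ → M, IsGeodesicFrom p v γ then h.choose 1 else p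

/-! ### Gradients -/

instance (x : M) [FiniteDimensional ℝ E] : CompleteSpace (TangentSpace 𝓘(ℝ, E) x) :=
  haveI : FiniteDimensional ℝ (TangentSpace 𝓘(ℝ, E) x) :=
    inferInstanceAs (FiniteDimensional ℝ E)
  FiniteDimensional.complete ℝ _

variable [FiniteDimensional ℝ E]

variable (E) in
/-- The Riemannian gradient: `⟨grad f(x), w⟩ = df(x) w` for all `w ∈ T_x M`. -/
def grad (f : M → ℝ) (x : M) : TangentSpace 𝓘(ℝ, E) x :=
  (InnerProductSpace.toDual ℝ (TangentSpace 𝓘(ℝ, E) x)).symm (mvfderiv 𝓘(ℝ, E) f x)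

variable (E) in
/-- `grad f` is Lipschitz continuous with constant `L`: for every geodesic segment
`γ : [0, 1] → M`, the parallel transport `V(1)` of `grad f(γ(0))` along `γ` satisfies
`‖V(1) - grad f(γ(1))‖ ≤ L ℓ(γ)`. The parallel field `V` along `γ` with `V(0) = grad f(γ(0))`
exists and is unique, and on a complete manifold the geodesic segments are the restrictions to
`[0, 1]` of the geodesics defined on `ℝ`. -/
def HasLipschitzGrad (f : M → ℝ) (L : ℝ) : Prop :=
  ∀ γ : ℝ → M, IsGeodesic E γ →
    ∃ V : ∀ t, TangentSpace 𝓘(ℝ, E) (γ t), IsParallelAlong γ V ∧ V 0 = grad E f (γ 0) ∧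
      ‖V 1 - grad E f (γ 1)‖ ≤ L * (pathELength 𝓘(ℝ, E) γ 0 1).toReal

variable {m : ℕ}

variable (E) in
/-- For `F = (f_1, …, f_m)`, the Jacobian `∇F` is componentwise Lipschitz continuous with
constant `L`. -/
def HasLipschitzJacobian (f : Fin m → M → ℝ) (L : ℝ) : Prop :=
  ∀ i, HasLipschitzGrad E (f i) L

/-! ### The steepest descent method -/

/-- The objective `max_i ⟨grad f_i(x), w⟩ + ‖w‖² / 2` of the direction search problem. -/
def descentObjective (f : Fin m → M → ℝ) (x : M) (w : TangentSpace 𝓘(ℝ, E) x) : ℝ :=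
  (⨆ i, inner ℝ (grad E (f i) x) w) + 1 / 2 * ‖w‖ ^ 2

/-- `v` is the steepest descent direction `v_x` for `F` at `x`. -/
def IsSteepestDescentDir (f : Fin m → M → ℝ) (x : M) (v : TangentSpace 𝓘(ℝ, E) x) : Prop :=
  IsMinOn (descentObjective f x) univ v

/-- `p_0, p_1, …` is an infinite sequence generated by the steepest descent method with steepest
descent directions `v_k ≠ 0` and stepsizes `t_k > 0`. -/
structure IsSteepestDescentRun (f : Fin m → M → ℝ) (p : ℕ → M)
    (v : ∀ k, TangentSpace 𝓘(ℝ, E) (p k)) (t : ℕ → ℝ) : Prop where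
  direction : ∀ k, IsSteepestDescentDir f (p k) (v k)
  direction_ne_zero : ∀ k, v k ≠ 0
  stepsize_pos : ∀ k, 0 < t k
  next : ∀ k, p (k + 1) = expMap (p k) (t k • v k)

/-- The sufficient decrease test `F(exp_x(s v)) ⪯ F(x) - c s ‖v‖² e`. -/
def SufficientDecrease (f : Fin m → M → ℝ) (c : ℝ) (x : M) (v : TangentSpace 𝓘(ℝ, E) x)
    (s : ℝ) : Prop :=
  ∀ i, f i (expMap x (s • v)) ≤ f i x - c * s * ‖v‖ ^ 2

/-- Lipschitz stepsize: `ε < t_k ≤ 1 / L`. -/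
structure IsLipschitzStepsize (L ε : ℝ) (t : ℕ → ℝ) : Prop where
  eps_pos : 0 < ε
  mem : ∀ k, t k ∈ Ioc ε (1 / L)

/-- The trial stepsize from which the adaptive search of step `k` starts: `1 / L₀` for `k = 0`, and
the previous stepsize `t_{k-1}` for `k ≥ 1`. -/
def adaptiveStart (L₀ : ℝ) (t : ℕ → ℝ) : ℕ → ℝ
  | 0 => 1 / L₀
  | k + 1 => t k

/-- Adaptive stepsize: `t_k = η ^ i_k * t_{k-1}`, with `t_{-1} = 1 / L₀` and `i_k` the least `i`
such that `η ^ i * t_{k-1}` passes the sufficient decrease test with constant `ζ`. -/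
structure IsAdaptiveStepsize (f : Fin m → M → ℝ) (p : ℕ → M)
    (v : ∀ k, TangentSpace 𝓘(ℝ, E) (p k)) (ζ L₀ η : ℝ) (t : ℕ → ℝ) : Prop where
  zeta_mem : ζ ∈ Ioc (0 : ℝ) (1 / 2)
  L₀_pos : 0 < L₀
  eta_mem : η ∈ Ioo (0 : ℝ) 1
  search : ∀ k, ∃ i : ℕ,
    IsLeast {j : ℕ | SufficientDecrease f ζ (p k) (v k) (η ^ j * adaptiveStart L₀ t k)} i ∧
      t k = η ^ i * adaptiveStart L₀ t k

/-- Armijo-type stepsize: `t_k` is the first trial stepsize that passes the sufficient decrease test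
with constant `δ`, in a backtracking search that starts anywhere in `[t_min, t_max]` and replaces
each rejected trial `s` by any number in `[ω₁ s, ω₂ s]`. -/
structure IsArmijoStepsize (f : Fin m → M → ℝ) (p : ℕ → M)
    (v : ∀ k, TangentSpace 𝓘(ℝ, E) (p k)) (tmin tmax ω₁ ω₂ δ : ℝ) (t : ℕ → ℝ) : Prop where
  tmin_pos : 0 < tmin
  tmin_lt_tmax : tmin < tmax
  omega₁_pos : 0 < ω₁
  omega₁_lt_omega₂ : ω₁ < ω₂
  omega₂_lt_one : ω₂ < 1
  delta_mem : δ ∈ Ioo (0 : ℝ) 1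
  search : ∀ k, ∃ (trial : ℕ → ℝ) (l : ℕ),
    trial 0 ∈ Icc tmin tmax ∧
    (∀ j < l, ¬ SufficientDecrease f δ (p k) (v k) (trial j) ∧
      trial (j + 1) ∈ Icc (ω₁ * trial j) (ω₂ * trial j)) ∧
    SufficientDecrease f δ (p k) (v k) (trial l) ∧
    t k = trial l

/-- The gap `h(x) - inf h`, where `inf h` may be `-∞`, in which case the gap is `+∞`. -/
def infGap (h : M → ℝ) (x : M) : EReal :=
  (h x : EReal) - ⨅ q, (h q : EReal)

end RiemannianDescent

end

/-! Parallel transport is isometric and a geodesic's velocity is parallel. So along a geodesic from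
`x` with velocity `v`, the Lipschitz condition bounds the derivative of `f_i` at time `s` by `⟨grad
f_i(x), v⟩ + L s ‖v‖²`. Hence `f_i(exp_x v) ≤ f_i(x) + ⟨grad f_i(x), v⟩ + L/2 ‖v‖²`
(`HasLipschitzGrad.expMap_le`), as in Euclidean space and with no curvature term.

Optimality of the steepest descent direction along its own ray gives `⟨grad f_i(x), v⟩ ≤ -‖v‖²` for
every `i`. Therefore any step up to `2 (1 - c) / L` passes the `c`-test. Rejected trials are thus
long, which keeps the accepted steps above `ξ`. Each iteration then lowers `f_i` by at least `ν ξ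
‖v_k‖²`, and the decreases telescope to at most the gap of `f_i`.

Since the connection is given by Christoffel symbols in charts, two facts are checked in
coordinates: compatibility with the metric (`hasDerivAt_inner_along`) and invariance of geodesics
under `u ↦ s u` (`IsGeodesic.comp_mul_left`). -/

namespace RiemannianDescent

/-! ### The metric and the Christoffel symbols in a chart -/

section Chart

variable {E : Type*} [NormedAddCommGroup E] [NormedSpace ℝ E]
  {M : Type*} [TopologicalSpace M] [ChartedSpace E M] [IsManifold 𝓘(ℝ, E) ∞ M]
  [RiemannianBundle (fun x : M => TangentSpace 𝓘(ℝ, E) x)]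

omit [RiemannianBundle (fun x : M => TangentSpace 𝓘(ℝ, E) x)] in
theorem extChartAt_symm_mem_baseSet {x₀ : M} {y : E}
    (hy : y ∈ (extChartAt 𝓘(ℝ, E) x₀).target) :
    (extChartAt 𝓘(ℝ, E) x₀).symm y ∈
      (trivializationAt E (fun x : M => TangentSpace 𝓘(ℝ, E) x) x₀).baseSet := by
  have := (extChartAt 𝓘(ℝ, E) x₀).map_target hy
  rwa [extChartAt_source] at this

theorem chartMetric_comm (x₀ : M) (y a b : E) : chartMetric x₀ y a b = chartMetric x₀ y b a :=
  real_inner_comm _ _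

/-- Over the chart target the bare inverse `symm` agrees with the linear map `symmL`, which is the
source of bilinearity. -/
theorem chartMetric_eq_symmL {x₀ : M} {y : E} (hy : y ∈ (extChartAt 𝓘(ℝ, E) x₀).target)
    (a b : E) :
    chartMetric x₀ y a b =
      let x := (extChartAt 𝓘(ℝ, E) x₀).symm y
      let e := trivializationAt E (fun x : M => TangentSpace 𝓘(ℝ, E) x) x₀
      inner ℝ (e.symmL ℝ x a) (e.symmL ℝ x b) := by
  have hb := extChartAt_symm_mem_baseSet hy
  simp only [chartMetric]
  rw [Trivialization.symmL_apply _ hb, Trivialization.symmL_apply _ hb]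

theorem chartMetric_add_left {x₀ : M} {y : E} (hy : y ∈ (extChartAt 𝓘(ℝ, E) x₀).target)
    (a a' b : E) :
    chartMetric x₀ y (a + a') b = chartMetric x₀ y a b + chartMetric x₀ y a' b := by
  simp only [chartMetric_eq_symmL hy, map_add, inner_add_left]

theorem chartMetric_smul_left {x₀ : M} {y : E} (hy : y ∈ (extChartAt 𝓘(ℝ, E) x₀).target)
    (s : ℝ) (a b : E) :
    chartMetric x₀ y (s • a) b = s * chartMetric x₀ y a b := by
  simp only [chartMetric_eq_symmL hy, map_smul, real_inner_smul_left]

theorem chartMetric_smul_right {x₀ : M} {y : E} (hy : y ∈ (extChartAt 𝓘(ℝ, E) x₀).target)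
    (s : ℝ) (a b : E) :
    chartMetric x₀ y a (s • b) = s * chartMetric x₀ y a b := by
  rw [chartMetric_comm, chartMetric_smul_left hy, chartMetric_comm]

theorem inner_eq_chartMetric {x₀ x : M} (hx : x ∈ (extChartAt 𝓘(ℝ, E) x₀).source)
    (v w : TangentSpace 𝓘(ℝ, E) x) :
    inner ℝ v w = chartMetric x₀ (extChartAt 𝓘(ℝ, E) x₀ x)
      (trivializationAt E (fun x : M => TangentSpace 𝓘(ℝ, E) x) x₀ ⟨x, v⟩).2
      (trivializationAt E (fun x : M => TangentSpace 𝓘(ℝ, E) x) x₀ ⟨x, w⟩).2 := by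
  have hb : x ∈ (trivializationAt E (fun x : M => TangentSpace 𝓘(ℝ, E) x) x₀).baseSet := by
    rwa [extChartAt_source] at hx
  simp only [chartMetric]
  rw [(extChartAt 𝓘(ℝ, E) x₀).left_inv hx, Trivialization.symm_apply_apply_mk _ hb,
    Trivialization.symm_apply_apply_mk _ hb]

/-- Each coordinate vector lifts to a differentiable map into the tangent bundle, and the metric is
smooth on the bundle. -/
theorem differentiableAt_chartMetric
    [IsContMDiffRiemannianBundle 𝓘(ℝ, E) ∞ E (fun x : M => TangentSpace 𝓘(ℝ, E) x)]
    {x₀ : M} {z : E × E × E} (hz : z.1 ∈ (extChartAt 𝓘(ℝ, E) x₀).target) :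
    DifferentiableAt ℝ (fun z : E × E × E => chartMetric x₀ z.1 z.2.1 z.2.2) z := by
  have hlift : ∀ g : E × E × E → E, DifferentiableAt ℝ g z →
      MDifferentiableAt 𝓘(ℝ, E × E × E) 𝓘(ℝ, E).tangent
        (fun z : E × E × E => (⟨(extChartAt 𝓘(ℝ, E) x₀).symm z.1,
          (trivializationAt E (fun x : M => TangentSpace 𝓘(ℝ, E) x) x₀).symm
            ((extChartAt 𝓘(ℝ, E) x₀).symm z.1) (g z)⟩ : TangentBundle 𝓘(ℝ, E) M)) z := by
    intro g hg
    have hev : ∀ᶠ z' : E × E × E in 𝓝 z, z'.1 ∈ (extChartAt 𝓘(ℝ, E) x₀).target :=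
      continuousAt_fst.eventually ((isOpen_extChartAt_target x₀).mem_nhds hz)
    rw [Trivialization.mdifferentiableAt_totalSpace_iff (IB := 𝓘(ℝ, E))
      (trivializationAt E (fun x : M => TangentSpace 𝓘(ℝ, E) x) x₀) _
      ((Trivialization.mem_source _).2 (extChartAt_symm_mem_baseSet hz))]
    constructor
    · have h1 : MDifferentiableAt 𝓘(ℝ, E) 𝓘(ℝ, E) (extChartAt 𝓘(ℝ, E) x₀).symm z.1 := by
        have := (contMDiffOn_extChartAt_symm (I := 𝓘(ℝ, E)) (n := ∞) x₀).contMDiffAt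
          ((isOpen_extChartAt_target x₀).mem_nhds hz)
        exact this.mdifferentiableAt (by simp)
      exact h1.comp z differentiableAt_fst.mdifferentiableAt
    · refine hg.mdifferentiableAt.congr_of_eventuallyEq ?_
      filter_upwards [hev] with z' hz'
      exact (Trivialization.apply_mk_symm _ (extChartAt_symm_mem_baseSet hz') _) ▸ rfl
  have := MDifferentiableAt.inner_bundle (IB := 𝓘(ℝ, E)) (F := E)
    (E := fun x : M => TangentSpace 𝓘(ℝ, E) x)
    (hlift (fun z => z.2.1) (by fun_prop)) (hlift (fun z => z.2.2) (by fun_prop))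
  exact this.differentiableAt

/-- Metric compatibility in coordinates: by symmetry of the metric, the other two derivative terms
are antisymmetric in `a` and `b` and cancel. -/
theorem christoffelFirst_add_swap (x₀ : M) (y a b w : E) :
    christoffelFirst x₀ y w a b + christoffelFirst x₀ y w b a =
      fderiv ℝ (fun z => chartMetric x₀ z a b) y w := by
  have h : ∀ a b : E, (fun z => chartMetric x₀ z a b) = fun z => chartMetric x₀ z b a :=
    fun a b => funext fun z => chartMetric_comm x₀ z a b
  simp only [christoffelFirst]
  rw [h w b, h w a, h b a]
  ring

theorem christoffelFirst_smul_smul {x₀ : M} {y : E}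
    (hy : y ∈ (extChartAt 𝓘(ℝ, E) x₀).target) (s r : ℝ) (a b w : E) :
    christoffelFirst x₀ y (s • a) (r • b) w = s * r * christoffelFirst x₀ y a b w := by
  have hev : ∀ᶠ z in 𝓝 y, z ∈ (extChartAt 𝓘(ℝ, E) x₀).target :=
    (isOpen_extChartAt_target x₀).mem_nhds hy
  have key : ∀ (c : ℝ) (g h : E → ℝ), (∀ᶠ z in 𝓝 y, g z = c * h z) →
      fderiv ℝ g y = c • fderiv ℝ h y := by
    intro c g h hgh
    rw [Filter.EventuallyEq.fderiv_eq hgh]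
    exact congrFun (fderiv_const_smul_field (𝕜 := ℝ) (f := h) c) y
  have h1 := key r (fun z => chartMetric x₀ z (r • b) w) (fun z => chartMetric x₀ z b w)
    (hev.mono fun z hz => chartMetric_smul_left hz r b w)
  have h2 := key s (fun z => chartMetric x₀ z (s • a) w) (fun z => chartMetric x₀ z a w)
    (hev.mono fun z hz => chartMetric_smul_left hz s a w)
  have h3 := key (s * r) (fun z => chartMetric x₀ z (s • a) (r • b))
    (fun z => chartMetric x₀ z a b)
    (hev.mono fun z hz => by
      rw [chartMetric_smul_left hz, chartMetric_smul_right hz, mul_assoc])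
  simp only [christoffelFirst, h1, h2, h3, map_smul, smul_apply, smul_eq_mul]
  ring

end Chart

/-! ### Parallel fields, geodesics and their reparametrization -/

section Curve

variable {E : Type*} [NormedAddCommGroup E] [NormedSpace ℝ E]
  {M : Type*} [TopologicalSpace M] [ChartedSpace E M] [IsManifold 𝓘(ℝ, E) ∞ M]
  [RiemannianBundle (fun x : M => TangentSpace 𝓘(ℝ, E) x)]

theorem fderiv_chartMetric_apply
    [IsContMDiffRiemannianBundle 𝓘(ℝ, E) ∞ E (fun x : M => TangentSpace 𝓘(ℝ, E) x)]
    {x₀ : M} {y : E} (hy : y ∈ (extChartAt 𝓘(ℝ, E) x₀).target) (a b y' a' b' : E) :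
    fderiv ℝ (fun z : E × E × E => chartMetric x₀ z.1 z.2.1 z.2.2) (y, a, b) (y', a', b') =
      fderiv ℝ (fun z => chartMetric x₀ z a b) y y' + chartMetric x₀ y a' b
        + chartMetric x₀ y b' a := by
  set G := fun z : E × E × E => chartMetric x₀ z.1 z.2.1 z.2.2 with hG
  have hd : HasFDerivAt G (fderiv ℝ G (y, a, b)) (y, a, b) :=
    (differentiableAt_chartMetric (z := (y, a, b)) hy).hasFDerivAt
  have h1 : fderiv ℝ (fun z => chartMetric x₀ z a b) y y' = fderiv ℝ G (y, a, b) (y', 0, 0) := by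
    have h : HasFDerivAt (fun z : E => (z, a, b)) (ContinuousLinearMap.inl ℝ E (E × E)) y := by
      exact hasFDerivAt_prodMk_left y (a, b)
    have := (hd.comp y h).fderiv
    exact congrArg (fun T : E →L[ℝ] ℝ => T y') this
  -- In the two vector slots it suffices to differentiate along lines on which only one vector
  -- varies; there the metric is affine in `s`.
  have hline : ∀ u : E × E, HasDerivAt (fun s : ℝ => G (y, a + s • u.1, b + s • u.2))
      (fderiv ℝ G (y, a, b) (0, u)) 0 := by
    intro u
    have h : HasDerivAt (fun s : ℝ => (y, a + s • u.1, b + s • u.2)) (0, u.1, u.2) 0 := by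
      refine (hasDerivAt_const _ _).prodMk (HasDerivAt.prodMk ?_ ?_)
      · simpa using ((hasDerivAt_id (0 : ℝ)).smul_const u.1).const_add a
      · simpa using ((hasDerivAt_id (0 : ℝ)).smul_const u.2).const_add b
    have hd' : HasFDerivAt G (fderiv ℝ G (y, a, b))
        (y, a + (0 : ℝ) • u.1, b + (0 : ℝ) • u.2) := by simpa using hd
    exact hd'.comp_hasDerivAt 0 h
  have haff : ∀ p q : ℝ, HasDerivAt (fun s : ℝ => p + s * q) q 0 := fun p q => by
    simpa using ((hasDerivAt_id (0 : ℝ)).mul_const q).const_add p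
  have h2 : fderiv ℝ G (y, a, b) (0, a', 0) = chartMetric x₀ y a' b := by
    refine (hline (a', 0)).unique ((haff (chartMetric x₀ y a b) _).congr_of_eventuallyEq ?_)
    refine Filter.Eventually.of_forall fun s => ?_
    simp only [hG, smul_zero, add_zero]
    rw [chartMetric_add_left hy, chartMetric_smul_left hy]
  have h3 : fderiv ℝ G (y, a, b) (0, 0, b') = chartMetric x₀ y b' a := by
    refine (hline (0, b')).unique ((haff (chartMetric x₀ y a b) _).congr_of_eventuallyEq ?_)
    refine Filter.Eventually.of_forall fun s => ?_
    simp only [hG, smul_zero, add_zero]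
    rw [chartMetric_comm, chartMetric_add_left hy, chartMetric_smul_left hy, chartMetric_comm]
  rw [h1, ← h2, ← h3, ← map_add, ← map_add]
  simp

/-- The Levi-Civita derivative along a curve is compatible with the metric. -/
theorem hasDerivAt_inner_along
    [IsContMDiffRiemannianBundle 𝓘(ℝ, E) ∞ E (fun x : M => TangentSpace 𝓘(ℝ, E) x)]
    {γ : ℝ → M} {V W : ∀ t, TangentSpace 𝓘(ℝ, E) (γ t)} {t : ℝ}
    (hV : MDifferentiableAt 𝓘(ℝ, ℝ) 𝓘(ℝ, E).tangent
      (fun s => (⟨γ s, V s⟩ : TangentBundle 𝓘(ℝ, E) M)) t)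
    (hW : MDifferentiableAt 𝓘(ℝ, ℝ) 𝓘(ℝ, E).tangent
      (fun s => (⟨γ s, W s⟩ : TangentBundle 𝓘(ℝ, E) M)) t) :
    HasDerivAt (fun s => inner ℝ (V s) (W s))
      (innerCovDerivAlong γ V t
          (trivializationAt E (fun x : M => TangentSpace 𝓘(ℝ, E) x) (γ t) ⟨γ t, W t⟩).2
        + innerCovDerivAlong γ W t
          (trivializationAt E (fun x : M => TangentSpace 𝓘(ℝ, E) x) (γ t) ⟨γ t, V t⟩).2) t := by
  obtain ⟨hγ, ha⟩ := (mdifferentiableAt_totalSpace _ _).1 hV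
  obtain ⟨-, hb⟩ := (mdifferentiableAt_totalSpace _ _).1 hW
  set c : ℝ → E := fun s => extChartAt 𝓘(ℝ, E) (γ t) (γ s) with hc_def
  set a : ℝ → E := fun s =>
    (trivializationAt E (fun x : M => TangentSpace 𝓘(ℝ, E) x) (γ t) ⟨γ s, V s⟩).2 with ha_def
  set b : ℝ → E := fun s =>
    (trivializationAt E (fun x : M => TangentSpace 𝓘(ℝ, E) x) (γ t) ⟨γ s, W s⟩).2 with hb_def
  have hc : HasDerivAt c (deriv c t) t := by
    have : MDifferentiableAt 𝓘(ℝ, ℝ) 𝓘(ℝ, E) c t :=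
      (mdifferentiableAt_extChartAt (mem_chart_source E (γ t))).comp t hγ
    exact this.differentiableAt.hasDerivAt
  have ha' : HasDerivAt a (deriv a t) t := ha.differentiableAt.hasDerivAt
  have hb' : HasDerivAt b (deriv b t) t := hb.differentiableAt.hasDerivAt
  have hy : c t ∈ (extChartAt 𝓘(ℝ, E) (γ t)).target :=
    (extChartAt 𝓘(ℝ, E) (γ t)).map_source (mem_extChartAt_source (γ t))
  have hG := (differentiableAt_chartMetric (z := (c t, a t, b t)) hy).hasFDerivAt.comp_hasDerivAt
    t (hc.prodMk (ha'.prodMk hb'))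
  -- The derivative of the metric along `c'` splits into two Christoffel terms, one for each
  -- covariant derivative.
  rw [fderiv_chartMetric_apply hy, ← christoffelFirst_add_swap] at hG
  have hev : (fun s => inner ℝ (V s) (W s)) =ᶠ[𝓝 t] fun s => chartMetric (γ t) (c s) (a s) (b s) := by
    have hsrc : ∀ᶠ s in 𝓝 t, γ s ∈ (extChartAt 𝓘(ℝ, E) (γ t)).source :=
      hγ.continuousAt.eventually (extChartAt_source_mem_nhds (γ t))
    filter_upwards [hsrc] with s hs
    exact inner_eq_chartMetric hs _ _
  refine (hG.congr_of_eventuallyEq hev).congr_deriv ?_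
  simp only [innerCovDerivAlong]
  ring

theorem IsParallelAlong.inner_eq
    [IsContMDiffRiemannianBundle 𝓘(ℝ, E) ∞ E (fun x : M => TangentSpace 𝓘(ℝ, E) x)]
    {γ : ℝ → M} {V W : ∀ t, TangentSpace 𝓘(ℝ, E) (γ t)}
    (hV : IsParallelAlong γ V) (hW : IsParallelAlong γ W) (s t : ℝ) :
    inner ℝ (V s) (W s) = inner ℝ (V t) (W t) := by
  have h : ∀ t, HasDerivAt (fun s => inner ℝ (V s) (W s)) 0 t := fun t => by
    simpa [(hV t).2, (hW t).2] using hasDerivAt_inner_along (hV t).1 (hW t).1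
  exact is_const_of_deriv_eq_zero (fun t => (h t).differentiableAt) (fun t => (h t).deriv) s t

theorem IsGeodesic.norm_velocity_eq
    [IsContMDiffRiemannianBundle 𝓘(ℝ, E) ∞ E (fun x : M => TangentSpace 𝓘(ℝ, E) x)]
    {γ : ℝ → M} (hγ : IsGeodesic E γ) (s t : ℝ) :
    ‖velocity E γ s‖ = ‖velocity E γ t‖ := by
  have h := IsParallelAlong.inner_eq hγ hγ s t
  rw [real_inner_self_eq_norm_sq, real_inner_self_eq_norm_sq] at h
  exact (sq_eq_sq₀ (norm_nonneg _) (norm_nonneg _)).1 h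

theorem IsGeodesic.toReal_pathELength
    [IsContMDiffRiemannianBundle 𝓘(ℝ, E) ∞ E (fun x : M => TangentSpace 𝓘(ℝ, E) x)]
    {γ : ℝ → M} (hγ : IsGeodesic E γ) :
    (pathELength 𝓘(ℝ, E) γ 0 1).toReal = ‖velocity E γ 0‖ := by
  have h : ∀ t, ‖mfderiv 𝓘(ℝ, ℝ) 𝓘(ℝ, E) γ t (1 : ℝ)‖ₑ = ‖velocity E γ 0‖ₑ := fun t => by
    rw [← ofReal_norm, ← ofReal_norm]
    exact congrArg _ (hγ.norm_velocity_eq t 0)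
  rw [pathELength_eq_lintegral_mfderiv_Icc]
  erw [MeasureTheory.lintegral_congr h]
  simp

theorem IsGeodesic.mdifferentiableAt {γ : ℝ → M} (hγ : IsGeodesic E γ) (t : ℝ) :
    MDifferentiableAt 𝓘(ℝ, ℝ) 𝓘(ℝ, E) γ t :=
  ((mdifferentiableAt_totalSpace _ _).1 (hγ t).1).1

omit [IsManifold 𝓘(ℝ, E) ∞ M] [RiemannianBundle (fun x : M => TangentSpace 𝓘(ℝ, E) x)] in
theorem velocity_comp_mul_left {γ : ℝ → M} (s t : ℝ)
    (hγ : MDifferentiableAt 𝓘(ℝ, ℝ) 𝓘(ℝ, E) γ (s * t)) :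
    velocity E (fun u => γ (s * u)) t = s • velocity E γ (s * t) := by
  have hs : HasDerivAt (fun u : ℝ => s * u) s t := by
    simpa using (hasDerivAt_id t).const_mul s
  have h := mfderiv_comp (I := 𝓘(ℝ, ℝ)) (I' := 𝓘(ℝ, ℝ)) (I'' := 𝓘(ℝ, E)) (f := fun u : ℝ => s * u)
    t hγ hs.differentiableAt.mdifferentiableAt
  unfold velocity
  change mfderiv 𝓘(ℝ, ℝ) 𝓘(ℝ, E) (γ ∘ fun u : ℝ => s * u) t (1 : ℝ) = _
  rw [h, mfderiv_eq_fderiv]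
  change (mfderiv 𝓘(ℝ, ℝ) 𝓘(ℝ, E) γ (s * t)) (fderiv ℝ (fun u : ℝ => s * u) t 1) = _
  rw [fderiv_apply_one_eq_deriv, hs.deriv]
  exact (congrArg (mfderiv 𝓘(ℝ, ℝ) 𝓘(ℝ, E) γ (s * t)) (by simp : s = s • (1 : ℝ))).trans
    (ContinuousLinearMap.map_smul _ s (1 : ℝ))

/-- An affine reparametrization of a geodesic fixing the initial point is a geodesic. -/
theorem IsGeodesic.comp_mul_left {γ : ℝ → M} (hγ : IsGeodesic E γ) (s : ℝ) :
    IsGeodesic E (fun u => γ (s * u)) := by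
  have hvel : velocity E (fun u => γ (s * u)) = fun u => s • velocity E γ (s * u) :=
    funext fun u => velocity_comp_mul_left s u (hγ.mdifferentiableAt _)
  unfold IsGeodesic
  rw [hvel]
  intro t
  set T := trivializationAt E (fun x : M => TangentSpace 𝓘(ℝ, E) x) (γ (s * t)) with hT
  have hmul : MDifferentiableAt 𝓘(ℝ, ℝ) 𝓘(ℝ, ℝ) (fun u : ℝ => s * u) t :=
    (differentiableAt_id.const_mul s).mdifferentiableAt
  have hγ' : MDifferentiableAt 𝓘(ℝ, ℝ) 𝓘(ℝ, E) (fun u => γ (s * u)) t :=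
    (hγ.mdifferentiableAt (s * t)).comp t hmul
  have hev : (fun u => (T ⟨γ (s * u), s • velocity E γ (s * u)⟩).2) =ᶠ[𝓝 t]
      fun u => s • (T ⟨γ (s * u), velocity E γ (s * u)⟩).2 := by
    have hsrc : ∀ᶠ u in 𝓝 t, γ (s * u) ∈ T.baseSet :=
      hγ'.continuousAt.eventually (T.open_baseSet.mem_nhds (mem_baseSet_trivializationAt _ _ _))
    filter_upwards [hsrc] with u hu
    exact (T.linear ℝ hu).map_smul s _
  have hdiff := ((mdifferentiableAt_totalSpace _ _).1 (hγ (s * t)).1).2.differentiableAt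
  constructor
  · refine (mdifferentiableAt_totalSpace _ _).2 ⟨hγ', ?_⟩
    refine MDifferentiableAt.congr_of_eventuallyEq ?_ hev
    exact ((hdiff.comp t (differentiableAt_id.const_mul s)).const_smul s).mdifferentiableAt
  · intro w
    have h0 := (hγ (s * t)).2 w
    have hy : extChartAt 𝓘(ℝ, E) (γ (s * t)) (γ (s * t)) ∈
        (extChartAt 𝓘(ℝ, E) (γ (s * t))).target :=
      (extChartAt 𝓘(ℝ, E) _).map_source (mem_extChartAt_source _)
    simp only [innerCovDerivAlong] at h0 ⊢
    rw [hev.deriv_eq, hev.eq_of_nhds]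
    have hda : deriv (fun u => s • (T ⟨γ (s * u), velocity E γ (s * u)⟩).2) t =
        (s * s) • deriv (fun r => (T ⟨γ r, velocity E γ r⟩).2) (s * t) := by
      rw [deriv_fun_const_smul_field, mul_smul]
      congr 1
      exact deriv_comp_mul_left s (fun r => (T ⟨γ r, velocity E γ r⟩).2) t
    have hdc : deriv (fun u => extChartAt 𝓘(ℝ, E) (γ (s * t)) (γ (s * u))) t =
        s • deriv (fun r => extChartAt 𝓘(ℝ, E) (γ (s * t)) (γ r)) (s * t) :=
      deriv_comp_mul_left s (fun r => extChartAt 𝓘(ℝ, E) (γ (s * t)) (γ r)) t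
    -- The second-derivative term and the Christoffel term, quadratic in the velocity, both scale by
    -- `s²`.
    rw [hda, hdc, chartMetric_smul_left hy, christoffelFirst_smul_smul hy, ← mul_add]
    exact mul_eq_zero_of_right _ h0

end Curve

/-! ### The quadratic upper bound along geodesics -/

section Descent

variable {E : Type*} [NormedAddCommGroup E] [NormedSpace ℝ E] [FiniteDimensional ℝ E]
  {M : Type*} [TopologicalSpace M] [ChartedSpace E M] [IsManifold 𝓘(ℝ, E) ∞ M]
  [RiemannianBundle (fun x : M => TangentSpace 𝓘(ℝ, E) x)]

omit [IsManifold 𝓘(ℝ, E) ∞ M] in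
theorem inner_grad (f : M → ℝ) (x : M) (w : TangentSpace 𝓘(ℝ, E) x) :
    inner ℝ (grad E f x) w = mvfderiv 𝓘(ℝ, E) f x w := by
  simp [grad]

omit [IsManifold 𝓘(ℝ, E) ∞ M] in
theorem hasDerivAt_comp_curve {f : M → ℝ} {γ : ℝ → M} {t : ℝ}
    (hf : MDifferentiableAt 𝓘(ℝ, E) 𝓘(ℝ, ℝ) f (γ t))
    (hγ : MDifferentiableAt 𝓘(ℝ, ℝ) 𝓘(ℝ, E) γ t) :
    HasDerivAt (fun s => f (γ s)) (inner ℝ (grad E f (γ t)) (velocity E γ t)) t := by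
  have hd : DifferentiableAt ℝ (f ∘ γ) t := (hf.comp t hγ).differentiableAt
  refine hd.hasDerivAt.congr_deriv ?_
  rw [inner_grad, ← fderiv_apply_one_eq_deriv, ← mfderiv_eq_fderiv, mfderiv_comp t hf hγ]
  rfl

/-- The descent inequality along a geodesic. -/
theorem HasLipschitzGrad.le_of_isGeodesic
    [IsContMDiffRiemannianBundle 𝓘(ℝ, E) ∞ E (fun x : M => TangentSpace 𝓘(ℝ, E) x)]
    {f : M → ℝ} (hf : MDifferentiable 𝓘(ℝ, E) 𝓘(ℝ, ℝ) f) {L : ℝ} (hL : HasLipschitzGrad E f L)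
    {γ : ℝ → M} (hγ : IsGeodesic E γ) :
    f (γ 1) ≤ f (γ 0) + inner ℝ (grad E f (γ 0)) (velocity E γ 0)
      + L / 2 * ‖velocity E γ 0‖ ^ 2 := by
  set g := inner ℝ (grad E f (γ 0)) (velocity E γ 0) with hg
  set n := ‖velocity E γ 0‖ with hn
  have hder : ∀ s, HasDerivAt (fun s => f (γ s))
      (inner ℝ (grad E f (γ s)) (velocity E γ s)) s :=
    fun s => hasDerivAt_comp_curve (hf _) (hγ.mdifferentiableAt s)
  -- The Lipschitz condition compares times `0` and `1` only, so it is applied to `u ↦ γ (s * u)`,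
  -- of length `s * n`.
  have hbound : ∀ s, 0 ≤ s →
      inner ℝ (grad E f (γ s)) (velocity E γ s) ≤ g + L * n ^ 2 * s := by
    intro s hs
    have hγs := hγ.comp_mul_left s
    -- The case `s = 0` is separate because a factor `s` is cancelled below.
    rcases hs.eq_or_lt with rfl | hs
    · simp [hg]
    obtain ⟨V, hVpar, hV0, hV1⟩ := hL _ hγs
    have hlen : (pathELength 𝓘(ℝ, E) (fun u => γ (s * u)) 0 1).toReal = s * n := by
      rw [hγs.toReal_pathELength, velocity_comp_mul_left s 0 (hγ.mdifferentiableAt _), norm_smul,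
        Real.norm_of_nonneg hs.le, hγ.norm_velocity_eq (s * 0) 0]
    rw [hlen] at hV1
    have hin := hVpar.inner_eq hγs 1 0
    rw [velocity_comp_mul_left s 0 (hγ.mdifferentiableAt _),
      velocity_comp_mul_left s 1 (hγ.mdifferentiableAt _), real_inner_smul_right,
      real_inner_smul_right, hV0] at hin
    have hin' := mul_left_cancel₀ hs.ne' hin
    have hcs : inner ℝ (grad E f (γ (s * 1)) - V 1) (velocity E γ (s * 1)) ≤ L * (s * n) * n := by
      refine (real_inner_le_norm _ _).trans ?_
      rw [norm_sub_rev, hγ.norm_velocity_eq (s * 1) 0]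
      exact mul_le_mul_of_nonneg_right hV1 (norm_nonneg _)
    rw [inner_sub_left, hin'] at hcs
    have e0 : inner ℝ (grad E f (γ (s * 0))) (velocity E γ (s * 0)) = g := by
      rw [hg, mul_zero]
    rw [e0, mul_one] at hcs
    linarith
  -- Monotonicity of the difference replaces integration of the derivative bound.
  have hanti : AntitoneOn (fun s => f (γ s) - (g * s + L / 2 * n ^ 2 * s ^ 2)) (Icc 0 1) := by
    have hd : ∀ s, HasDerivAt (fun s => f (γ s) - (g * s + L / 2 * n ^ 2 * s ^ 2))
        (inner ℝ (grad E f (γ s)) (velocity E γ s) - (g + L * n ^ 2 * s)) s := by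
      intro s
      refine ((hder s).sub (((hasDerivAt_id s).const_mul g).add
        ((hasDerivAt_pow 2 s).const_mul (L / 2 * n ^ 2)))).congr_deriv ?_
      simp
      ring
    refine antitoneOn_of_deriv_nonpos (convex_Icc 0 1)
      (fun s _ => (hd s).continuousAt.continuousWithinAt)
      (fun s _ => (hd s).differentiableAt.differentiableWithinAt) fun s hs => ?_
    rw [interior_Icc] at hs
    rw [(hd s).deriv]
    linarith [hbound s hs.1.le]
  have := hanti (left_mem_Icc.2 zero_le_one) (right_mem_Icc.2 zero_le_one) zero_le_one
  simp only at this
  linarith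

omit [FiniteDimensional ℝ E] in
theorem exists_isGeodesicFrom_expMap (hM : IsCompleteRiemannian E M) (x : M)
    (v : TangentSpace 𝓘(ℝ, E) x) : ∃ γ : ℝ → M, IsGeodesicFrom x v γ ∧ expMap x v = γ 1 := by
  have h := hM x v
  exact ⟨h.choose, h.choose_spec, by rw [expMap, dif_pos h]⟩

theorem HasLipschitzGrad.expMap_le
    [IsContMDiffRiemannianBundle 𝓘(ℝ, E) ∞ E (fun x : M => TangentSpace 𝓘(ℝ, E) x)]
    (hM : IsCompleteRiemannian E M)
    {f : M → ℝ} (hf : MDifferentiable 𝓘(ℝ, E) 𝓘(ℝ, ℝ) f) {L : ℝ} (hL : HasLipschitzGrad E f L)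
    (x : M) (v : TangentSpace 𝓘(ℝ, E) x) :
    f (expMap x v) ≤ f x + inner ℝ (grad E f x) v + L / 2 * ‖v‖ ^ 2 := by
  obtain ⟨γ, ⟨hγ, h0⟩, hexp⟩ := exists_isGeodesicFrom_expMap hM x v
  have key := hL.le_of_isGeodesic hf hγ
  -- The initial condition is an equality in the tangent bundle; stating the bound as a function of
  -- a bundle point avoids casts between fibres.
  have htransfer : ∀ z : TangentBundle 𝓘(ℝ, E) M, z = ⟨x, v⟩ →
      f z.1 + inner ℝ (grad E f z.1) z.2 + L / 2 * ‖z.2‖ ^ 2 =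
        f x + inner ℝ (grad E f x) v + L / 2 * ‖v‖ ^ 2 := by
    rintro _ rfl
    rfl
  rw [hexp, ← htransfer _ h0]
  exact key

end Descent

/-! ### Decrease along the steepest descent direction -/

section SteepestDescent

variable {E : Type*} [NormedAddCommGroup E] [NormedSpace ℝ E] [FiniteDimensional ℝ E]
  {M : Type*} [TopologicalSpace M] [ChartedSpace E M] [IsManifold 𝓘(ℝ, E) ∞ M]
  [RiemannianBundle (fun x : M => TangentSpace 𝓘(ℝ, E) x)] {m : ℕ}

omit [IsManifold 𝓘(ℝ, E) ∞ M] in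
-- On the ray `s • v` the objective is `s a + s² ‖v‖² / 2`, minimal at `s = 1`, so `a = -‖v‖²`.
theorem IsSteepestDescentDir.inner_grad_le {f : Fin m → M → ℝ} {x : M}
    {v : TangentSpace 𝓘(ℝ, E) x} (hv : IsSteepestDescentDir f x v) (i : Fin m) :
    inner ℝ (grad E (f i) x) v ≤ -‖v‖ ^ 2 := by
  set a := ⨆ i, inner ℝ (grad E (f i) x) v with ha
  have hval : ∀ s : ℝ, 0 ≤ s →
      descentObjective f x (s • v) = s * a + 1 / 2 * (s ^ 2 * ‖v‖ ^ 2) := by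
    intro s hs
    rw [descentObjective, norm_smul, mul_pow, Real.norm_eq_abs, sq_abs, ha,
      Real.mul_iSup_of_nonneg hs]
    simp only [real_inner_smul_right]
  -- Only `s > 0` near `1` is used, since a nonnegative factor is needed to leave the supremum.
  have hmin : IsLocalMin (fun s : ℝ => s * a + 1 / 2 * (s ^ 2 * ‖v‖ ^ 2)) 1 := by
    filter_upwards [lt_mem_nhds one_pos] with s hs
    rw [← hval s hs.le, ← hval 1 zero_le_one, one_smul]
    exact hv (mem_univ _)
  have hder : HasDerivAt (fun s : ℝ => s * a + 1 / 2 * (s ^ 2 * ‖v‖ ^ 2)) (a + ‖v‖ ^ 2) 1 := by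
    refine (((hasDerivAt_id (1 : ℝ)).mul_const a).add
      (((hasDerivAt_pow 2 (1 : ℝ)).mul_const (‖v‖ ^ 2)).const_mul (1 / 2))).congr_deriv ?_
    norm_num
    ring
  have h0 := hmin.hasDerivAt_eq_zero hder
  have hle : inner ℝ (grad E (f i) x) v ≤ a :=
    le_ciSup (f := fun i => inner ℝ (grad E (f i) x) v) (Set.finite_range _).bddAbove i
  linarith

variable [IsContMDiffRiemannianBundle 𝓘(ℝ, E) ∞ E (fun x : M => TangentSpace 𝓘(ℝ, E) x)]

/-- Decrease along the steepest descent direction with an arbitrary stepsize. -/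
theorem IsSteepestDescentDir.expMap_le (hM : IsCompleteRiemannian E M) {f : Fin m → M → ℝ}
    (hf : ∀ i, ContMDiff 𝓘(ℝ, E) 𝓘(ℝ, ℝ) 1 (f i)) {L : ℝ} (hL : HasLipschitzJacobian E f L)
    {x : M} {v : TangentSpace 𝓘(ℝ, E) x} (hv : IsSteepestDescentDir f x v) {s : ℝ} (hs : 0 ≤ s)
    (i : Fin m) :
    f i (expMap x (s • v)) ≤ f i x - (1 - L * s / 2) * s * ‖v‖ ^ 2 := by
  have h := (hL i).expMap_le hM ((hf i).mdifferentiable one_ne_zero) x (s • v)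
  rw [real_inner_smul_right, norm_smul, mul_pow, Real.norm_eq_abs, sq_abs] at h
  have h' := mul_le_mul_of_nonneg_left (hv.inner_grad_le i) hs
  linarith

/-- Every stepsize up to `2 (1 - c) / L` passes the test with constant `c`. -/
theorem IsSteepestDescentDir.sufficientDecrease (hM : IsCompleteRiemannian E M)
    {f : Fin m → M → ℝ} (hf : ∀ i, ContMDiff 𝓘(ℝ, E) 𝓘(ℝ, ℝ) 1 (f i)) {L : ℝ} (hL₀ : 0 < L)
    (hL : HasLipschitzJacobian E f L) {x : M} {v : TangentSpace 𝓘(ℝ, E) x}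
    (hv : IsSteepestDescentDir f x v) {c s : ℝ} (hs : 0 ≤ s) (hsc : s ≤ 2 * (1 - c) / L) :
    SufficientDecrease f c x v s := by
  intro i
  refine (hv.expMap_le hM hf hL hs i).trans ?_
  rw [le_div_iff₀ hL₀] at hsc
  have : c * (s * ‖v‖ ^ 2) ≤ (1 - L * s / 2) * (s * ‖v‖ ^ 2) :=
    mul_le_mul_of_nonneg_right (by linarith) (by positivity)
  linarith

end SteepestDescent

/-! ### Lower bounds for the three stepsize strategies -/

section Stepsizes

variable {E : Type*} [NormedAddCommGroup E] [NormedSpace ℝ E] [FiniteDimensional ℝ E]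
  {M : Type*} [TopologicalSpace M] [ChartedSpace E M] [IsManifold 𝓘(ℝ, E) ∞ M]
  [RiemannianBundle (fun x : M => TangentSpace 𝓘(ℝ, E) x)] {m : ℕ}
  {f : Fin m → M → ℝ} {p : ℕ → M} {v : ∀ k, TangentSpace 𝓘(ℝ, E) (p k)} {t : ℕ → ℝ} {L : ℝ}

omit [FiniteDimensional ℝ E] in
theorem IsAdaptiveStepsize.sufficientDecrease {ζ L₀ η : ℝ}
    (h : IsAdaptiveStepsize f p v ζ L₀ η t) (k : ℕ) : SufficientDecrease f ζ (p k) (v k) (t k) := by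
  obtain ⟨i, hi, ht⟩ := h.search k
  rw [ht]
  exact hi.1

omit [FiniteDimensional ℝ E] in
theorem IsArmijoStepsize.sufficientDecrease {tmin tmax ω₁ ω₂ δ : ℝ}
    (h : IsArmijoStepsize f p v tmin tmax ω₁ ω₂ δ t) (k : ℕ) :
    SufficientDecrease f δ (p k) (v k) (t k) := by
  obtain ⟨trial, l, -, -, hl, ht⟩ := h.search k
  rwa [ht]

variable [IsContMDiffRiemannianBundle 𝓘(ℝ, E) ∞ E (fun x : M => TangentSpace 𝓘(ℝ, E) x)]

/-- Without backtracking the step inherits the bound from its start; `η L₀ ≤ L` covers the first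
start. Otherwise the last rejected trial exceeds `2 (1 - ζ) / L ≥ 1 / L`, as `ζ ≤ 1/2`, and is
shortened by `η` once. -/
theorem IsAdaptiveStepsize.le_stepsize (hM : IsCompleteRiemannian E M)
    (hf : ∀ i, ContMDiff 𝓘(ℝ, E) 𝓘(ℝ, ℝ) 1 (f i)) (hL₀ : 0 < L)
    (hL : HasLipschitzJacobian E f L) (hrun : IsSteepestDescentRun f p v t) {ζ L₀ η : ℝ}
    (h : IsAdaptiveStepsize f p v ζ L₀ η t) (hη : η * L₀ ≤ L) (k : ℕ) : η / L ≤ t k := by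
  have hη₀ := h.eta_mem.1
  have step : ∀ k, η / L ≤ adaptiveStart L₀ t k → η / L ≤ t k := by
    intro k hk
    obtain ⟨i, hi, ht⟩ := h.search k
    rw [ht]
    have hstart : 0 < adaptiveStart L₀ t k := (div_pos hη₀ hL₀).trans_le hk
    cases i with
    | zero => simpa using hk
    | succ i =>
      have hfail : ¬ SufficientDecrease f ζ (p k) (v k) (η ^ i * adaptiveStart L₀ t k) :=
        fun hs => (Nat.lt_succ_self i).not_ge (hi.2 hs)
      have hlt : 2 * (1 - ζ) / L < η ^ i * adaptiveStart L₀ t k := by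
        by_contra! hle
        exact hfail ((hrun.direction k).sufficientDecrease hM hf hL₀ hL (by positivity) hle)
      have h1 : 1 / L ≤ η ^ i * adaptiveStart L₀ t k :=
        (div_le_div_of_nonneg_right (by linarith [h.zeta_mem.2]) hL₀.le).trans hlt.le
      calc η / L = η * (1 / L) := by ring
        _ ≤ η * (η ^ i * adaptiveStart L₀ t k) := mul_le_mul_of_nonneg_left h1 hη₀.le
        _ = η ^ (i + 1) * adaptiveStart L₀ t k := by ring
  induction k with
  | zero =>
    refine step 0 ?_
    rw [adaptiveStart, div_le_div_iff₀ hL₀ h.L₀_pos]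
    linarith
  | succ k ih => exact step (k + 1) ih

/-- Either the first trial is accepted, or the last rejected one exceeds `2 (1 - δ) / L` and shrinks
by a factor of at least `ω₁`; the upper bound on `tmin` is what makes this enough. -/
theorem IsArmijoStepsize.le_stepsize (hM : IsCompleteRiemannian E M)
    (hf : ∀ i, ContMDiff 𝓘(ℝ, E) 𝓘(ℝ, ℝ) 1 (f i)) (hL₀ : 0 < L)
    (hL : HasLipschitzJacobian E f L) (hrun : IsSteepestDescentRun f p v t)
    {tmin tmax ω₁ ω₂ δ : ℝ} (h : IsArmijoStepsize f p v tmin tmax ω₁ ω₂ δ t)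
    (htmin : tmin < 2 * ω₁ * (1 - δ) / L) (k : ℕ) : tmin ≤ t k := by
  obtain ⟨trial, l, h0, hback, -, ht⟩ := h.search k
  have hpos : ∀ j ≤ l, 0 < trial j := by
    intro j
    induction j with
    | zero => exact fun _ => h.tmin_pos.trans_le h0.1
    | succ j ih =>
      exact fun hj => (mul_pos h.omega₁_pos (ih (by omega))).trans_le (hback j (by omega)).2.1
  rw [ht]
  cases l with
  | zero => exact h0.1
  | succ l =>
    obtain ⟨hfail, hmem⟩ := hback l (Nat.lt_succ_self l)
    have hlt : 2 * (1 - δ) / L < trial l := by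
      by_contra! hle
      exact hfail ((hrun.direction k).sufficientDecrease hM hf hL₀ hL
        (hpos l (Nat.le_succ l)).le hle)
    calc tmin ≤ 2 * ω₁ * (1 - δ) / L := htmin.le
      _ = ω₁ * (2 * (1 - δ) / L) := by ring
      _ ≤ ω₁ * trial l := mul_le_mul_of_nonneg_left hlt.le h.omega₁_pos.le
      _ ≤ trial (l + 1) := hmem.1

/-- The value `ν = 1/2` is the `c` for which `2 (1 - c) / L = 1 / L`. -/
theorem IsLipschitzStepsize.sufficientDecrease (hM : IsCompleteRiemannian E M)
    (hf : ∀ i, ContMDiff 𝓘(ℝ, E) 𝓘(ℝ, ℝ) 1 (f i)) (hL₀ : 0 < L)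
    (hL : HasLipschitzJacobian E f L) (hrun : IsSteepestDescentRun f p v t) {ε : ℝ}
    (h : IsLipschitzStepsize L ε t) (k : ℕ) :
    SufficientDecrease f (1 / 2) (p k) (v k) (t k) :=
  (hrun.direction k).sufficientDecrease hM hf hL₀ hL (hrun.stepsize_pos k).le
    ((h.mem k).2.trans_eq (by norm_num))

end Stepsizes

/-! ### Finite gaps, telescoping and the rate -/

theorem sub_le_toReal_infGap {M : Type*} {h : M → ℝ} {x : M} (hx : infGap h x ≠ ⊤) (y : M) :
    h x - h y ≤ (infGap h x).toReal := by
  have hle : ((h x - h y : ℝ) : EReal) ≤ infGap h x := by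
    rw [EReal.coe_sub]
    exact EReal.sub_le_sub le_rfl (iInf_le _ y)
  -- Finiteness matters here: `toReal` sends `⊤` to `0`.
  exact EReal.toReal_le_toReal hle (EReal.coe_ne_bot _) hx

theorem infGap_ne_top {M : Type*} {h : M → ℝ} (hh : BddBelow (Set.range h)) (x : M) :
    infGap h x ≠ ⊤ := by
  obtain ⟨b, hb⟩ := hh
  have hle : infGap h x ≤ ((h x - b : ℝ) : EReal) := by
    rw [EReal.coe_sub]
    exact EReal.sub_le_sub le_rfl
      (le_iInf fun q => EReal.coe_le_coe_iff.2 (hb (Set.mem_range_self q)))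
  exact (hle.trans_lt (EReal.coe_lt_top _)).ne

/-- Telescoping: if `c n_k² ≤ g_k - g_{k+1}`, the least of `n_0, …, n_{N-1}` is `O(1 / √N)`. -/
theorem inf'_le_of_telescoping {g n : ℕ → ℝ} (hn : ∀ k, 0 ≤ n k) {c A : ℝ} (hc : 0 < c)
    (hg : ∀ k, c * n k ^ 2 ≤ g k - g (k + 1)) {N : ℕ} (hN : N ≠ 0) (hA : g 0 - g N ≤ A) :
    (Finset.range N).inf' (Finset.nonempty_range_iff.mpr hN) n ≤ √(A / c) * (1 / √(N : ℝ)) := by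
  set μ := (Finset.range N).inf' (Finset.nonempty_range_iff.mpr hN) n with hμ
  have hμ₀ : 0 ≤ μ := (Finset.le_inf'_iff _ _).2 fun k _ => hn k
  have hN' : (0 : ℝ) < N := by exact_mod_cast Nat.pos_of_ne_zero hN
  have hsum : N * (c * μ ^ 2) ≤ g 0 - g N := by
    rw [← Finset.sum_range_sub' g N]
    have := Finset.card_nsmul_le_sum (Finset.range N) (fun k => g k - g (k + 1)) (c * μ ^ 2)
      fun k hk => (mul_le_mul_of_nonneg_left
        (pow_le_pow_left₀ hμ₀ (Finset.inf'_le n hk) 2) hc.le).trans (hg k)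
    simpa using this
  rw [mul_one_div, ← Real.sqrt_div' _ hN'.le]
  refine Real.le_sqrt_of_sq_le ?_
  rw [div_div, le_div_iff₀ (mul_pos hc hN')]
  linarith

section Rate

variable {E : Type*} [NormedAddCommGroup E] [NormedSpace ℝ E] [FiniteDimensional ℝ E]
  {M : Type*} [TopologicalSpace M] [ChartedSpace E M] [IsManifold 𝓘(ℝ, E) ∞ M]
  [RiemannianBundle (fun x : M => TangentSpace 𝓘(ℝ, E) x)] {m : ℕ}
  {f : Fin m → M → ℝ} {p : ℕ → M} {v : ∀ k, TangentSpace 𝓘(ℝ, E) (p k)} {t : ℕ → ℝ}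

/-- Rate of convergence for any stepsizes `t_k ≥ ξ` passing the test with constant `ν`. -/
theorem IsSteepestDescentRun.inf'_norm_le (hrun : IsSteepestDescentRun f p v t) {i : Fin m}
    (hi : infGap (f i) (p 0) ≠ ⊤) {ν ξ : ℝ} (hν : 0 < ν) (hξ : 0 < ξ)
    (hdec : ∀ k, SufficientDecrease f ν (p k) (v k) (t k)) (ht : ∀ k, ξ ≤ t k)
    {N : ℕ} (hN : N ≠ 0) :
    (Finset.range N).inf' (Finset.nonempty_range_iff.mpr hN) (fun k => ‖v k‖) ≤
      √((infGap (f i) (p 0)).toReal / (ν * ξ)) * (1 / √(N : ℝ)) := by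
  refine inf'_le_of_telescoping (g := fun k => f i (p k)) (fun k => norm_nonneg _)
    (mul_pos hν hξ) (fun k => ?_) hN (sub_le_toReal_infGap hi (p N))
  have h := hdec k i
  rw [← hrun.next k] at h
  have h' : ν * ξ * ‖v k‖ ^ 2 ≤ ν * t k * ‖v k‖ ^ 2 :=
    mul_le_mul_of_nonneg_right (mul_le_mul_of_nonneg_left (ht k) hν.le) (sq_nonneg _)
  linarith

end Rate

end RiemannianDescent

theorem mainTheorem3
    {E : Type*} [NormedAddCommGroup E] [NormedSpace ℝ E] [FiniteDimensional ℝ E]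
    {M : Type*} [TopologicalSpace M] [T2Space M] [ChartedSpace E M] [IsManifold 𝓘(ℝ, E) ∞ M]
    [RiemannianBundle (fun x : M => TangentSpace 𝓘(ℝ, E) x)]
    [IsContMDiffRiemannianBundle 𝓘(ℝ, E) ∞ E (fun x : M => TangentSpace 𝓘(ℝ, E) x)]
    (hM : RiemannianDescent.IsCompleteRiemannian E M)
    {m : ℕ} (f : Fin m → M → ℝ)
    (hf : ∀ i, ContMDiff 𝓘(ℝ, E) 𝓘(ℝ, ℝ) 1 (f i))
    (L : ℝ) (hL : 0 < L) (hfL : RiemannianDescent.HasLipschitzJacobian E f L)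
    (hbdd : ∃ i, BddBelow (Set.range (f i)))
    (p : ℕ → M) (v : ∀ k, TangentSpace 𝓘(ℝ, E) (p k)) (t : ℕ → ℝ)
    (hrun : RiemannianDescent.IsSteepestDescentRun f p v t)
    (i : Fin m)
    (hi : ∀ j, RiemannianDescent.infGap (f i) (p 0) ≤ RiemannianDescent.infGap (f j) (p 0))
    (N : ℕ) (hN : N ≠ 0) :
    (∀ ε : ℝ, RiemannianDescent.IsLipschitzStepsize L ε t →
      (Finset.range N).inf' (Finset.nonempty_range_iff.mpr hN) (fun k => ‖v k‖) ≤
        √((RiemannianDescent.infGap (f i) (p 0)).toReal / (1 / 2 * ε)) * (1 / √(N : ℝ))) ∧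
    (∀ ζ L₀ η : ℝ, RiemannianDescent.IsAdaptiveStepsize f p v ζ L₀ η t → η * L₀ ≤ L →
      (Finset.range N).inf' (Finset.nonempty_range_iff.mpr hN) (fun k => ‖v k‖) ≤
        √((RiemannianDescent.infGap (f i) (p 0)).toReal / (ζ * (η / L))) * (1 / √(N : ℝ))) ∧
    (∀ tmin tmax ω₁ ω₂ δ : ℝ,
      RiemannianDescent.IsArmijoStepsize f p v tmin tmax ω₁ ω₂ δ t →
      tmin < 2 * ω₁ * (1 - δ) / L →
      (Finset.range N).inf' (Finset.nonempty_range_iff.mpr hN) (fun k => ‖v k‖) ≤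
        √((RiemannianDescent.infGap (f i) (p 0)).toReal / (δ * tmin)) * (1 / √(N : ℝ))) := by
  obtain ⟨j, hj⟩ := hbdd
  -- Some gap is finite, hence so is the minimal one, even though `f i` is not assumed bounded
  -- below.
  have htop : RiemannianDescent.infGap (f i) (p 0) ≠ ⊤ :=
    ((hi j).trans_lt (lt_top_iff_ne_top.2 (RiemannianDescent.infGap_ne_top hj (p 0)))).ne
  refine ⟨fun ε h => ?_, fun ζ L₀ η h hη => ?_, fun tmin tmax ω₁ ω₂ δ h htmin => ?_⟩
  · exact hrun.inf'_norm_le htop one_half_pos h.eps_pos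
      (h.sufficientDecrease hM hf hL hfL hrun) (fun k => (h.mem k).1.le) hN
  · exact hrun.inf'_norm_le htop h.zeta_mem.1 (div_pos h.eta_mem.1 hL) h.sufficientDecrease
      (h.le_stepsize hM hf hL hfL hrun hη) hN
  · exact hrun.inf'_norm_le htop h.delta_mem.1 h.tmin_pos h.sufficientDecrease
      (h.le_stepsize hM hf hL hfL hrun htmin) hN
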